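/- All graphs are finite and simple. For a vertex $v$ of a graph $G$, let $N[v]$ be its closed neighbourhood ($v$ together with its neighbours). A locally identifying coloring (lid-coloring) of $G$ with $k$ colors is a proper vertex coloring $f : V(G) \to \{1,\dots,k\}$ such that $f(N[u]) \neq f(N[v])$ for every edge $uv$ with $N[u] \neq N[v]$. Let $\chi_{lid}(G)$ be the least $k$ such that $G$ has a lid-coloring with $k$ colors. Let $C_n$ be the cycle on $n$ vertices. Let $G \times H$ be the tensor product of $G$ and $H$: its vertex set is $V(G) \times V(H)$, and $(u_1,v_1)$, $(u_2,v_2)$ are adjacent if and only if $u_1u_2 \in E(G)$ and $v_1v_2 \in E(H)$. **Theorem.** Let $m$ and $n$ be two positive integers such that $3 \le m \le n$. Then $$ \chi_{lid}(C_m \times C_n) = \begin{cases} 5 & \text{if } m = 3 \text{ and } n \in \{3,5\};\\ 4 & \text{if } m = 3 \text{ and } n = 7;\\ 4 & \text{if } m \in \{5,7\} \text{ and } n \in \{5,7\};\\ 4 & \text{if } n \ge 9 \text{ and both } m \text{ and } n \text{ are odd};\\ 3 & \text{otherwise, i.e. if } m \text{ or } n \text{ is even.} \end{cases} $$ -/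

import Mathlib

namespace SimpleGraph

/-- The tensor product `G × H`: `(u₁, v₁)` and `(u₂, v₂)` are adjacent iff `u₁ u₂` is an edge
of `G` and `v₁ v₂` is an edge of `H`. -/
def tensorProduct {V W : Type*} (G : SimpleGraph V) (H : SimpleGraph W) :
    SimpleGraph (V × W) where
  Adj x y := G.Adj x.1 y.1 ∧ H.Adj x.2 y.2
  symm := ⟨fun _ _ h => ⟨h.1.symm, h.2.symm⟩⟩
  loopless := ⟨fun x h => G.loopless.irrefl x.1 h.1⟩

/-- The closed neighbourhood `N[v]`. -/
def closedNeighborSet {V : Type*} (G : SimpleGraph V) (v : V) : Set V :=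
  insert v (G.neighborSet v)

/-- A proper coloring is locally identifying if any two adjacent vertices with distinct closed
neighbourhoods have distinct sets of colors in their closed neighbourhoods. -/
def IsLidColoring {V α : Type*} (G : SimpleGraph V) (f : G.Coloring α) : Prop :=
  ∀ u v : V, G.Adj u v → G.closedNeighborSet u ≠ G.closedNeighborSet v →
    f '' G.closedNeighborSet u ≠ f '' G.closedNeighborSet v

/-- `G` has a locally identifying coloring with the colors `Fin k`. -/
def LidColorable {V : Type*} (G : SimpleGraph V) (k : ℕ) : Prop :=
  ∃ f : G.Coloring (Fin k), G.IsLidColoring f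

/-- The locally identifying chromatic number: the least `k` such that `G` has a locally
identifying coloring with `k` colors (and `⊤` if there is no such `k`). -/
noncomputable def lidChromaticNumber {V : Type*} (G : SimpleGraph V) : ℕ∞ :=
  ⨅ k ∈ {k : ℕ | G.LidColorable k}, (k : ℕ∞)

end SimpleGraph

/-!
Lower bounds. No edge of `C_m × C_n` joins two vertices with the same closed neighborhood
(`closedNeighborSet_ne_of_adj`), so the lid condition applies to every edge. At an edge `uv` the
colors of `u` and `v` occur in both closed neighborhoods. With two colors both neighborhoods
therefore see the same set. With three colors exactly one end of each edge sees all three, so the graph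
is bipartite (`LidColorable.isBipartite`); but the diagonal is an odd closed walk when `m` and `n` are
odd. For `C_3 × C_3` and `C_3 × C_5` four colors are excluded by a search over the possible
columns, evaluated by the kernel.

Upper bounds. The lid condition at an edge `(i, j) (i + 1, j ± 1)` involves only the rows
`i - 1, …, i + 2` and four consecutive columns. So a coloring is a lid-coloring as soon as all its
`4 × 4` patches are good (`lidColorable_of_patchOK`). Cut both cycles into blocks whose lengths lie
in fixed finite sets `S` and `S'`, and color the `b × c` rectangle spanned by two blocks by a tile
depending only on `b` and `c`. If the tiles are such that all patches that can occur, in whatever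
order the blocks follow each other, are good, then the product of any two cycles that can be cut in
this way is colored (`lidColorable_of_tiles`). The sets `{3, 4, 5}` and `{4, 6}` with three colors
cover every cycle times an even cycle, `{4, 5, 7}` twice with four colors covers all odd lengths
from `5` on, `{3}` and `{4, 7, 9}` with four colors covers a triangle times an odd cycle of length at
least `7`, and `{3}` and `{3, 5}` with five colors covers the two exceptional products.
-/

namespace SimpleGraph

/-! ### Lid-colorings of general graphs -/

section General

variable {V W : Type*} {G : SimpleGraph V} {H : SimpleGraph W}

theorem mem_closedNeighborSet {u v : V} : u ∈ G.closedNeighborSet v ↔ u = v ∨ G.Adj v u :=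
  Iff.rfl

theorem IsLidColoring.exists_comp {α β : Type*} {f : G.Coloring α} (hf : G.IsLidColoring f)
    {g : α → β} (hg : Function.Injective g) :
    ∃ f' : G.Coloring β, G.IsLidColoring f' ∧ ∀ v, f' v = g (f v) := by
  refine ⟨Coloring.mk (fun v => g (f v)) fun {u v} huv he => f.valid huv (hg he),
    fun u v huv hne he => hf u v huv hne ?_, fun _ => rfl⟩
  change (fun v => g (f v)) '' _ = (fun v => g (f v)) '' _ at he
  rw [← Set.image_image g f, ← Set.image_image g f] at he
  exact hg.image_injective he

theorem LidColorable.mono {j k : ℕ} (hjk : j ≤ k) (h : G.LidColorable j) : G.LidColorable k := by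
  obtain ⟨f, hf⟩ := h
  obtain ⟨f', hf', -⟩ := hf.exists_comp (Fin.castLE_injective hjk)
  exact ⟨f', hf'⟩

theorem LidColorable.of_iso {k : ℕ} (e : G ≃g H) (h : H.LidColorable k) : G.LidColorable k := by
  obtain ⟨f, hf⟩ := h
  have key : ∀ v, e '' G.closedNeighborSet v = H.closedNeighborSet (e v) := by
    intro v
    ext w
    obtain ⟨w, rfl⟩ := e.surjective w
    simp [mem_closedNeighborSet, e.map_adj_iff]
  refine ⟨Coloring.mk (fun v => f (e v)) fun {u v} huv =>
    f.valid (e.map_adj_iff.2 huv), fun u v huv hne he => ?_⟩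
  change (fun v => f (e v)) '' _ = (fun v => f (e v)) '' _ at he
  refine hf (e u) (e v) (e.map_adj_iff.2 huv) ?_ ?_
  · rw [← key, ← key]
    exact fun h => hne (e.injective.image_injective h)
  · rw [← key, ← key, Set.image_image, Set.image_image]
    exact he

theorem lidChromaticNumber_eq_succ {k : ℕ} (h : G.LidColorable (k + 1)) (h' : ¬ G.LidColorable k) :
    G.lidChromaticNumber = (k + 1 : ℕ) := by
  refine le_antisymm (iInf₂_le (k + 1) h) (le_iInf₂ fun j hj => ?_)
  by_contra hlt
  have : j < k + 1 := by exact_mod_cast not_le.1 hlt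
  exact h' (LidColorable.mono (Nat.le_of_lt_succ this) hj)

theorem apply_mem_image_closedNeighborSet {α : Type*} (f : V → α) {u v : V} (h : G.Adj u v) :
    f u ∈ f '' G.closedNeighborSet u ∧ f v ∈ f '' G.closedNeighborSet u :=
  ⟨⟨u, Or.inl rfl, rfl⟩, ⟨v, Or.inr h, rfl⟩⟩

theorem not_lidColorable_two {u v : V} (huv : G.Adj u v)
    (hne : G.closedNeighborSet u ≠ G.closedNeighborSet v) : ¬ G.LidColorable 2 := by
  rintro ⟨f, hf⟩
  have huniv : ∀ (s : Set (Fin 2)) (x y : Fin 2), x ≠ y → x ∈ s → y ∈ s → s = Set.univ := by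
    intro s x y hxy hx hy
    refine Set.eq_univ_of_forall fun z => ?_
    have : z = x ∨ z = y := by omega
    rcases this with rfl | rfl <;> assumption
  have h1 := apply_mem_image_closedNeighborSet f huv
  have h2 := apply_mem_image_closedNeighborSet f huv.symm
  exact hf u v huv hne ((huniv _ _ _ (f.valid huv) h1.1 h1.2).trans
    (huniv _ _ _ (f.valid huv) h2.2 h2.1).symm)

/-- If no edge joins twins and there are three colors, then both closed neighborhoods at an edge
contain the two colors of the edge, so exactly one of them sees all three colors: the vertices that
do are one side of a bipartition. -/
theorem LidColorable.isBipartite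
    (hG : ∀ u v, G.Adj u v → G.closedNeighborSet u ≠ G.closedNeighborSet v)
    (h : G.LidColorable 3) : G.IsBipartite := by
  classical
  obtain ⟨f, hf⟩ := h
  have huniv : ∀ (s t : Set (Fin 3)) (x y : Fin 3), x ≠ y → x ∈ s → y ∈ s → x ∈ t → y ∈ t →
      (s = Set.univ ↔ t = Set.univ) → s = t := by
    intro s t x y hxy hxs hys hxt hyt hst
    obtain ⟨z, hz⟩ : ∃ z : Fin 3, ∀ w, w = x ∨ w = y ∨ w = z := by
      clear hxs hys hxt hyt
      revert x y
      decide
    have key : ∀ s : Set (Fin 3), x ∈ s → y ∈ s → (s = Set.univ ↔ z ∈ s) := fun s hx hy =>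
      ⟨fun h => h ▸ Set.mem_univ z, fun hz' => Set.eq_univ_of_forall fun w => by
        rcases hz w with rfl | rfl | rfl <;> assumption⟩
    rw [key s hxs hys, key t hxt hyt] at hst
    ext w
    rcases hz w with rfl | rfl | rfl
    · exact iff_of_true hxs hxt
    · exact iff_of_true hys hyt
    · exact hst
  refine ⟨Coloring.mk
    (fun v => if f '' G.closedNeighborSet v = Set.univ then (0 : Fin 2) else 1) ?_⟩
  intro u v huv he
  have h1 := apply_mem_image_closedNeighborSet f huv
  have h2 := apply_mem_image_closedNeighborSet f huv.symm
  refine hf u v huv (hG u v huv)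
    (huniv _ _ _ _ (f.valid huv) h1.1 h1.2 h2.2 h2.1 ?_)
  by_cases a : f '' G.closedNeighborSet u = Set.univ <;>
    by_cases b : f '' G.closedNeighborSet v = Set.univ <;> simp_all

/-- The tensor product is commutative. -/
def tensorProductComm (G : SimpleGraph V) (H : SimpleGraph W) :
    G.tensorProduct H ≃g H.tensorProduct G where
  toEquiv := Equiv.prodComm V W
  map_rel_iff' := and_comm

end General

/-! ### Neighborhoods in products of cycles -/

section Cycle

variable {m n : ℕ}

theorem cycleGraph_adj_iff {i j : Fin (m + 3)} :
    (cycleGraph (m + 3)).Adj i j ↔ j = i + 1 ∨ i = j + 1 := by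
  rw [cycleGraph_adj, or_comm, sub_eq_iff_eq_add', sub_eq_iff_eq_add']

theorem add_one_add_one_ne (i : Fin (m + 3)) : i + 1 + 1 ≠ i := by
  intro h
  have h2 : (1 : Fin (m + 3)) + 1 = 0 := by
    rwa [add_assoc, add_eq_left] at h
  have h3 := congrArg Fin.val h2
  simp only [Fin.val_add, Fin.val_one, Fin.val_zero] at h3
  rw [Nat.mod_eq_of_lt (by omega)] at h3
  omega

theorem cycleGraph_adj_add_one_iff {i x : Fin (m + 3)} :
    (cycleGraph (m + 3)).Adj (i + 1) x ↔ x = i ∨ x = i + 1 + 1 := by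
  rw [cycleGraph_adj_iff, add_left_inj, or_comm, eq_comm (a := i)]

theorem closedNeighborSet_tensorProduct_cycleGraph (i : Fin (m + 3)) (j : Fin (n + 3)) :
    ((cycleGraph (m + 3)).tensorProduct (cycleGraph (n + 3))).closedNeighborSet (i + 1, j + 1) =
      {(i + 1, j + 1), (i, j), (i, j + 1 + 1), (i + 1 + 1, j), (i + 1 + 1, j + 1 + 1)} := by
  ext ⟨x, y⟩
  rw [mem_closedNeighborSet]
  simp only [tensorProduct, cycleGraph_adj_add_one_iff, Set.mem_insert_iff,
    Set.mem_singleton_iff, Prod.mk.injEq]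
  tauto

/-- No edge of a product of two cycles joins twins: if `d` is the neighbor of `v.2` other
than `u.2`, then `(u.1, d)` is a neighbor of `v` but not of `u`. -/
theorem closedNeighborSet_ne_of_adj (u v : Fin (m + 3) × Fin (n + 3))
    (h : ((cycleGraph (m + 3)).tensorProduct (cycleGraph (n + 3))).Adj u v) :
    ((cycleGraph (m + 3)).tensorProduct (cycleGraph (n + 3))).closedNeighborSet u ≠
      ((cycleGraph (m + 3)).tensorProduct (cycleGraph (n + 3))).closedNeighborSet v := by
  obtain ⟨h1, h2⟩ := h
  obtain ⟨d, hd, hne⟩ : ∃ d, (cycleGraph (n + 3)).Adj v.2 d ∧ d ≠ u.2 := by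
    rcases cycleGraph_adj_iff.1 h2 with h | h
    · exact ⟨v.2 + 1, cycleGraph_adj_iff.2 (Or.inl rfl), h ▸ add_one_add_one_ne _⟩
    · refine ⟨v.2 - 1, cycleGraph_adj_iff.2 (Or.inr (sub_add_cancel _ _).symm), ?_⟩
      rw [h]
      nth_rewrite 2 [← sub_add_cancel v.2 1]
      exact (add_one_add_one_ne _).symm
  intro he
  have hmem : (u.1, d) ∈
      ((cycleGraph (m + 3)).tensorProduct (cycleGraph (n + 3))).closedNeighborSet v :=
    mem_closedNeighborSet.2 (Or.inr ⟨h1.symm, hd⟩)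
  rw [← he, mem_closedNeighborSet] at hmem
  rcases hmem with h | h
  · exact hne (congrArg Prod.snd h)
  · exact h.1.ne rfl

theorem not_isBipartite_tensorProduct_cycleGraph (hm : Odd (m + 3)) (hn : Odd (n + 3)) :
    ¬ ((cycleGraph (m + 3)).tensorProduct (cycleGraph (n + 3))).IsBipartite := by
  rintro ⟨c⟩
  -- The diagonal `t ↦ (t, t)` is a closed walk of odd length `(m + 3) * (n + 3)`.
  have key : ∀ t : ℕ, Even t ↔ c (Fin.ofNat (m + 3) t, Fin.ofNat (n + 3) t) = c (0, 0) := by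
    intro t
    induction t with
    | zero => exact iff_of_true Even.zero rfl
    | succ t ih =>
      have hstep : ∀ l : ℕ, Fin.ofNat (l + 3) (t + 1) = Fin.ofNat (l + 3) t + 1 := fun l =>
        Fin.ext (by simp [Fin.val_add])
      have h : c (Fin.ofNat (m + 3) t, Fin.ofNat (n + 3) t) ≠
          c (Fin.ofNat (m + 3) (t + 1), Fin.ofNat (n + 3) (t + 1)) :=
        c.valid ⟨cycleGraph_adj_iff.2 (Or.inl (hstep m)), cycleGraph_adj_iff.2 (Or.inl (hstep n))⟩
      rw [Nat.even_add_one, ih]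
      revert h
      generalize c (Fin.ofNat (m + 3) t, Fin.ofNat (n + 3) t) = x
      generalize c (Fin.ofNat (m + 3) (t + 1), Fin.ofNat (n + 3) (t + 1)) = y
      generalize c (0, 0) = z
      revert x y z
      decide
  have h := (key ((m + 3) * (n + 3))).2 ?_
  · exact Nat.not_even_iff_odd.2 (hm.mul hn) h
  · congr 2
    · exact Fin.ext (Nat.mul_mod_right _ _)
    · exact Fin.ext (Nat.mul_mod_left _ _)

end Cycle

/-! ### The lid condition on patches -/

/-- The set `{x, a, b, c, d}` of colors, encoded as the number whose binary digits are its
characteristic function. -/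
def colorMask (x a b c d : ℕ) : ℕ := 2 ^ x ||| 2 ^ a ||| 2 ^ b ||| 2 ^ c ||| 2 ^ d

theorem testBit_colorMask (x a b c d i : ℕ) :
    (colorMask x a b c d).testBit i = true ↔ i = x ∨ i = a ∨ i = b ∨ i = c ∨ i = d := by
  simp only [colorMask, Nat.testBit_or, Nat.testBit_two_pow, Bool.or_eq_true, decide_eq_true_eq,
    eq_comm (b := i), or_assoc]

theorem colorMask_eq_iff {k : ℕ} {x a b c d x' a' b' c' d' : Fin k} :
    colorMask x a b c d = colorMask x' a' b' c' d' ↔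
      ({x, a, b, c, d} : Set (Fin k)) = {x', a', b', c', d'} := by
  have hext : ∀ a b : ℕ, a = b ↔ ∀ i, a.testBit i = true ↔ b.testBit i = true := fun a b =>
    ⟨fun h i => h ▸ Iff.rfl, fun h => Nat.eq_of_testBit_eq fun i => Bool.eq_iff_iff.2 (h i)⟩
  rw [hext]
  simp only [testBit_colorMask, Set.ext_iff, Set.mem_insert_iff,
    Set.mem_singleton_iff]
  constructor
  · intro h y
    simpa only [Fin.val_inj] using h y
  · intro h i
    by_cases hi : i < k
    · simpa only [← Fin.val_inj] using h ⟨i, hi⟩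
    · exact iff_of_false (by omega) (by omega)

/-- In the patch of a colored product of two cycles with the consecutive rows `a, b, c, d` and the
consecutive columns `p, q, r, s`, the two edges that cross in the middle, `(b, q) (c, r)` and
`(b, r) (c, q)`, have ends of distinct colors and with distinct sets of colors in their closed
neighborhoods. -/
def patchOK {α β : Type*} (C : α → β → ℕ) (a b c d : α) (p q r s : β) : Bool :=
  C b q != C c r && C b r != C c q &&
  colorMask (C b q) (C a p) (C a r) (C c p) (C c r) !=
    colorMask (C c r) (C b q) (C b s) (C d q) (C d s) &&
  colorMask (C b r) (C a q) (C a s) (C c q) (C c s) !=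
    colorMask (C c q) (C b p) (C b r) (C d p) (C d r)

theorem IsLidColoring.patchOK {m n k : ℕ}
    {f : ((cycleGraph (m + 3)).tensorProduct (cycleGraph (n + 3))).Coloring (Fin k)}
    (hf : ((cycleGraph (m + 3)).tensorProduct (cycleGraph (n + 3))).IsLidColoring f)
    (i : Fin (m + 3)) (j : Fin (n + 3)) :
    patchOK (fun x y => (f (x, y) : ℕ)) i (i + 1) (i + 1 + 1) (i + 1 + 1 + 1)
      j (j + 1) (j + 1 + 1) (j + 1 + 1 + 1) = true := by
  simp only [SimpleGraph.patchOK, Bool.and_eq_true, bne_iff_ne, ne_eq, Fin.val_inj,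
    colorMask_eq_iff]
  have h1 : ((cycleGraph (m + 3)).tensorProduct (cycleGraph (n + 3))).Adj
      (i + 1, j + 1) (i + 1 + 1, j + 1 + 1) :=
    ⟨cycleGraph_adj_iff.2 (Or.inl rfl), cycleGraph_adj_iff.2 (Or.inl rfl)⟩
  have h2 : ((cycleGraph (m + 3)).tensorProduct (cycleGraph (n + 3))).Adj
      (i + 1, j + 1 + 1) (i + 1 + 1, j + 1) :=
    ⟨cycleGraph_adj_iff.2 (Or.inl rfl), cycleGraph_adj_iff.2 (Or.inr rfl)⟩
  have l1 := hf _ _ h1 (closedNeighborSet_ne_of_adj _ _ h1)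
  have l2 := hf _ _ h2 (closedNeighborSet_ne_of_adj _ _ h2)
  simp only [closedNeighborSet_tensorProduct_cycleGraph, Set.image_insert_eq,
    Set.image_singleton] at l1 l2
  exact ⟨⟨⟨f.valid h1, f.valid h2⟩, l1⟩, l2⟩

theorem lidColorable_of_patchOK {m n k : ℕ} (F : Fin (m + 3) → Fin (n + 3) → Fin k)
    (hF : ∀ i j, patchOK (fun x y => (F x y : ℕ)) i (i + 1) (i + 1 + 1) (i + 1 + 1 + 1)
      j (j + 1) (j + 1 + 1) (j + 1 + 1 + 1) = true) :
    ((cycleGraph (m + 3)).tensorProduct (cycleGraph (n + 3))).LidColorable k := by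
  simp only [patchOK, Bool.and_eq_true, bne_iff_ne, ne_eq, Fin.val_inj, colorMask_eq_iff] at hF
  let f : Fin (m + 3) × Fin (n + 3) → Fin k := fun v => F v.1 v.2
  -- By symmetry an edge may be taken to go from a row `i + 1` to the next row.
  have key : ∀ u v, ((cycleGraph (m + 3)).tensorProduct (cycleGraph (n + 3))).Adj u v →
      f u ≠ f v ∧
      f '' ((cycleGraph (m + 3)).tensorProduct (cycleGraph (n + 3))).closedNeighborSet u ≠
      f '' ((cycleGraph (m + 3)).tensorProduct (cycleGraph (n + 3))).closedNeighborSet v := by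
    have up : ∀ (i : Fin (m + 3)) (y z : Fin (n + 3)), (cycleGraph (n + 3)).Adj y z →
        f (i + 1, y) ≠ f (i + 1 + 1, z) ∧
        f '' ((cycleGraph (m + 3)).tensorProduct
          (cycleGraph (n + 3))).closedNeighborSet (i + 1, y) ≠
        f '' ((cycleGraph (m + 3)).tensorProduct
          (cycleGraph (n + 3))).closedNeighborSet (i + 1 + 1, z) := by
      intro i y z hyz
      rcases cycleGraph_adj_iff.1 hyz with rfl | rfl
      · obtain ⟨j, rfl⟩ : ∃ j, y = j + 1 := ⟨y - 1, (sub_add_cancel _ _).symm⟩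
        simp only [closedNeighborSet_tensorProduct_cycleGraph, Set.image_insert_eq,
          Set.image_singleton]
        exact ⟨(hF i j).1.1.1, (hF i j).1.2⟩
      · obtain ⟨j, rfl⟩ : ∃ j, z = j + 1 := ⟨z - 1, (sub_add_cancel _ _).symm⟩
        simp only [closedNeighborSet_tensorProduct_cycleGraph, Set.image_insert_eq,
          Set.image_singleton]
        exact ⟨(hF i j).1.1.2, (hF i j).2⟩
    rintro ⟨x, y⟩ ⟨w, z⟩ ⟨hxw, hyz⟩
    rcases cycleGraph_adj_iff.1 hxw with h | h
    · obtain ⟨i, rfl⟩ : ∃ i, x = i + 1 := ⟨x - 1, (sub_add_cancel _ _).symm⟩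
      dsimp only at h
      subst h
      exact up i y z hyz
    · obtain ⟨i, rfl⟩ : ∃ i, w = i + 1 := ⟨w - 1, (sub_add_cancel _ _).symm⟩
      dsimp only at h
      subst h
      exact (up i z y hyz.symm).imp Ne.symm Ne.symm
  exact ⟨Coloring.mk f fun {u v} h => (key u v h).1, fun u v h _ => (key u v h).2⟩

/-! ### Colorings by tiles -/

/-- Successors in the digraph of blocks: a state `(b, i)` is the position `i` in a block of length
`b`, and the last position of a block is followed by the first position of any block whose length
is in `S`. -/
def blockSucc (S : List ℕ) (x : ℕ × ℕ) : List (ℕ × ℕ) :=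
  if x.2 + 1 < x.1 then [(x.1, x.2 + 1)] else S.map fun b => (b, 0)

/-- The states of the blocks with lengths in `S`. -/
def blockStates (S : List ℕ) : List (ℕ × ℕ) :=
  S.flatMap fun b => (List.range b).map fun i => (b, i)

/-- The walks on four vertices in the digraph of blocks. -/
def blockWalks (S : List ℕ) : List ((ℕ × ℕ) × (ℕ × ℕ) × (ℕ × ℕ) × (ℕ × ℕ)) :=
  (blockStates S).flatMap fun a => (blockSucc S a).flatMap fun b =>
    (blockSucc S b).flatMap fun c => (blockSucc S c).map fun d => (a, b, c, d)

/-- The color that the tiles `T` give to the cell in row `x.2` and column `y.2` of the tile with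
`x.1` rows and `y.1` columns; it is `0` outside the tile, where it is never used. -/
def tileColor (T : ℕ → ℕ → List (List ℕ)) (x y : ℕ × ℕ) : ℕ :=
  ((T x.1 y.1).getD x.2 []).getD y.2 0

/-- A cycle of length `p + q * k` is cut into one block of length `p` followed by `k` blocks of
length `q`; the vertex `i` is sent to its block length and its position in the block. -/
def cutCycle (p q : ℕ) (i : ℕ) : ℕ × ℕ := if i < p then (p, i) else (q, (i - p) % q)

theorem cutCycle_mem_blockStates {S : List ℕ} {p q : ℕ} (hp : p ∈ S) (hq : q ∈ S) (hq0 : 0 < q)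
    (i : ℕ) : cutCycle p q i ∈ blockStates S := by
  simp only [blockStates, List.mem_flatMap, List.mem_map, List.mem_range, cutCycle]
  split_ifs with h
  · exact ⟨p, hp, i, h, rfl⟩
  · exact ⟨q, hq, _, Nat.mod_lt _ hq0, rfl⟩

theorem cutCycle_succ_mem_blockSucc {S : List ℕ} {p q : ℕ} (hp : p ∈ S) (hq : q ∈ S) (hp0 : 0 < p)
    (hq0 : 0 < q) {m k : ℕ} (hm : m + 3 = p + q * k) (i : Fin (m + 3)) :
    cutCycle p q (i + 1 : Fin (m + 3)) ∈ blockSucc S (cutCycle p q i) := by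
  have hlast : ∀ (b c j : ℕ), ¬ j + 1 < b → c ∈ S → (c, 0) ∈ blockSucc S (b, j) := by
    intro b c j hj hc
    simp only [blockSucc, if_neg hj]
    exact List.mem_map.2 ⟨c, hc, rfl⟩
  have hnext : ∀ (b j : ℕ), j + 1 < b → (b, j + 1) ∈ blockSucc S (b, j) := by
    intro b j hj
    simp [blockSucc, if_pos hj]
  have hmod : ∀ t, (t + 1) % q = if t % q + 1 < q then t % q + 1 else 0 := by
    intro t
    have := Nat.mod_lt t hq0
    rw [← Nat.mod_add_mod]
    split_ifs with h
    · exact Nat.mod_eq_of_lt h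
    · rw [show t % q + 1 = q by omega, Nat.mod_self]
  rw [Fin.val_add_one]
  split_ifs with hi
  · have hi' : (i : ℕ) = m + 2 := by rw [hi]; rfl
    rw [show cutCycle p q 0 = (p, 0) from if_pos hp0, cutCycle]
    split_ifs with h
    · exact hlast _ _ _ (by omega) hp
    · -- The last vertex of the cycle ends a block, because `q` divides `m + 3 - p`.
      refine hlast _ _ _ ?_ hp
      have h0 : ((i : ℕ) - p + 1) % q = 0 := by
        rw [show (i : ℕ) - p + 1 = q * k by omega, Nat.mul_mod_right]
      rw [hmod] at h0
      split_ifs at h0 with h1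
      exact h1
  · unfold cutCycle
    by_cases h : (i : ℕ) + 1 < p
    · rw [if_pos h, if_pos (by omega)]
      exact hnext _ _ h
    · rw [if_neg h]
      by_cases h' : (i : ℕ) < p
      · rw [if_pos h', show (i : ℕ) + 1 - p = 0 by omega, Nat.zero_mod]
        exact hlast _ _ _ h hq
      · rw [if_neg h', show (i : ℕ) + 1 - p = (i - p) + 1 by omega, hmod]
        split_ifs with h1
        · exact hnext _ _ h1
        · exact hlast _ _ _ h1 hq

theorem patchOK_comp {α β γ δ : Type*} (C : α → β → ℕ) (f : γ → α) (g : δ → β) (a b c d : γ)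
    (p q r s : δ) :
    patchOK (fun x y => C (f x) (g y)) a b c d p q r s =
      patchOK C (f a) (f b) (f c) (f d) (g p) (g q) (g r) (g s) := rfl

/-- If in every tiling by `T`, with row blocks of lengths in `S` and column blocks of lengths in
`S'`, any four consecutive rows and four consecutive columns form a good patch, then `T` gives a
lid-coloring of the product of any two cycles that are cut into such blocks. This reduces infinitely
many graphs to finitely many patches. -/
theorem lidColorable_of_tiles {S S' : List ℕ} {T : ℕ → ℕ → List (List ℕ)} {K : ℕ}
    (hlt : ∀ x ∈ blockStates S, ∀ y ∈ blockStates S', tileColor T x y < K)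
    (hT : ((blockWalks S).all fun w => (blockWalks S').all fun v =>
      patchOK (tileColor T) w.1 w.2.1 w.2.2.1 w.2.2.2 v.1 v.2.1 v.2.2.1 v.2.2.2) = true)
    (hS : 0 ∉ S) (hS' : 0 ∉ S') {m p q k : ℕ} (hp : p ∈ S) (hq : q ∈ S) (hm : m = p + q * k)
    (hm3 : 3 ≤ m) {n p' q' k' : ℕ} (hp' : p' ∈ S') (hq' : q' ∈ S') (hn : n = p' + q' * k')
    (hn3 : 3 ≤ n) :
    ((cycleGraph m).tensorProduct (cycleGraph n)).LidColorable K := by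
  obtain ⟨m, rfl⟩ := Nat.exists_eq_add_of_le' hm3
  obtain ⟨n, rfl⟩ := Nat.exists_eq_add_of_le' hn3
  have pos : ∀ {S : List ℕ}, 0 ∉ S → ∀ {x}, x ∈ S → 0 < x := fun h _ hx =>
    Nat.pos_of_ne_zero fun h0 => h (h0 ▸ hx)
  have hwalk : ∀ {S : List ℕ} {p q l k : ℕ}, 0 ∉ S → p ∈ S → q ∈ S → l + 3 = p + q * k →
      ∀ i : Fin (l + 3),
      (cutCycle p q i, cutCycle p q (i + 1 : Fin (l + 3)), cutCycle p q (i + 1 + 1 : Fin (l + 3)),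
        cutCycle p q (i + 1 + 1 + 1 : Fin (l + 3))) ∈ blockWalks S := by
    intro S p q l k hS hp hq hl i
    have h := cutCycle_succ_mem_blockSucc hp hq (pos hS hp) (pos hS hq) hl
    refine List.mem_flatMap.2 ⟨_, cutCycle_mem_blockStates hp hq (pos hS hq) i, ?_⟩
    refine List.mem_flatMap.2 ⟨_, h i, ?_⟩
    refine List.mem_flatMap.2 ⟨_, h (i + 1), ?_⟩
    exact List.mem_map.2 ⟨_, h (i + 1 + 1), rfl⟩
  refine lidColorable_of_patchOK (fun i j => ⟨tileColor T (cutCycle p q i) (cutCycle p' q' j),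
    hlt _ (cutCycle_mem_blockStates hp hq (pos hS hq) i) _
      (cutCycle_mem_blockStates hp' hq' (pos hS' hq') j)⟩)
    fun i j => ?_
  have h := List.all_eq_true.1 (List.all_eq_true.1 hT _ (hwalk hS hp hq hm i)) _
    (hwalk hS' hp' hq' hn j)
  rwa [← patchOK_comp (tileColor T) (fun i : Fin (m + 3) => cutCycle p q i)
    (fun j : Fin (n + 3) => cutCycle p' q' j)] at h

/-! ### The tiles -/

/-- Three colors, for row blocks of lengths `3, 4, 5` and column blocks of lengths `4, 6`. Color `0`
fills every other column; a vertex in one of the remaining columns sees only its own color and `0`,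
while the colors `1` and `2` are distributed there in such a way that every vertex of color `0` sees
both. -/
def tileEven : ℕ → ℕ → List (List ℕ)
  | 3, 4 => [[0, 1, 0, 2], [0, 1, 0, 2], [0, 2, 0, 1]]
  | 3, 6 => [[0, 2, 0, 2, 0, 1], [0, 1, 0, 2, 0, 2], [0, 2, 0, 1, 0, 1]]
  | 4, 4 => [[0, 1, 0, 1], [0, 1, 0, 1], [0, 1, 0, 2], [0, 1, 0, 2]]
  | 4, 6 => [[0, 1, 0, 1, 0, 1], [0, 1, 0, 1, 0, 2], [0, 1, 0, 2, 0, 2], [0, 1, 0, 2, 0, 1]]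
  | 5, 4 => [[0, 1, 0, 1], [0, 1, 0, 1], [0, 1, 0, 2], [0, 2, 0, 1], [0, 2, 0, 1]]
  | 5, 6 => [[0, 1, 0, 1, 0, 2], [0, 1, 0, 2, 0, 2], [0, 1, 0, 2, 0, 1], [0, 2, 0, 1, 0, 2],
      [0, 2, 0, 2, 0, 1]]
  | _, _ => []

/-- Four colors, for row and column blocks of lengths `4, 5, 7`. -/
def tileOdd : ℕ → ℕ → List (List ℕ)
  | 4, 4 => [[0, 0, 2, 0], [1, 1, 1, 3], [0, 0, 0, 2], [3, 1, 1, 1]]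
  | 4, 5 => [[2, 0, 0, 2, 0], [1, 1, 3, 3, 3], [0, 0, 0, 2, 2], [1, 1, 1, 1, 1]]
  | 4, 7 => [[0, 0, 0, 2, 0, 2, 2], [1, 1, 1, 1, 3, 1, 3], [0, 3, 2, 0, 0, 2, 2],
      [1, 1, 1, 1, 1, 3, 1]]
  | 5, 4 => [[0, 0, 2, 0], [1, 1, 3, 3], [0, 0, 0, 0], [3, 3, 2, 2], [1, 1, 1, 1]]
  | 5, 5 => [[2, 0, 0, 2, 0], [3, 1, 1, 3, 3], [0, 0, 0, 0, 0], [2, 3, 3, 2, 2], [1, 1, 1, 1, 1]]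
  | 5, 7 => [[0, 0, 2, 2, 0, 2, 2], [1, 1, 3, 3, 1, 1, 3], [0, 0, 0, 0, 0, 0, 0],
      [3, 3, 2, 2, 3, 2, 2], [1, 1, 1, 1, 1, 1, 1]]
  | 7, 4 => [[2, 0, 3, 2], [1, 1, 1, 0], [2, 2, 2, 3], [0, 1, 0, 0], [3, 1, 3, 3], [0, 2, 0, 2],
      [3, 1, 1, 1]]
  | 7, 5 => [[2, 0, 3, 3, 0], [1, 0, 1, 1, 0], [3, 2, 2, 2, 3], [0, 1, 1, 0, 1],
      [3, 3, 3, 3, 3], [0, 2, 2, 0, 0], [3, 1, 1, 1, 1]]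
  | 7, 7 => [[2, 0, 3, 2, 0, 3, 0], [1, 1, 1, 1, 1, 1, 1], [2, 2, 3, 3, 2, 2, 3],
      [0, 1, 1, 0, 0, 0, 0], [3, 3, 3, 3, 3, 3, 3], [0, 2, 2, 0, 2, 0, 1], [3, 1, 1, 1, 1, 3, 1]]
  | _, _ => []

/-- Four colors, for three rows and column blocks of lengths `4, 7, 9`. -/
def tileThree : ℕ → ℕ → List (List ℕ)
  | 3, 4 => [[0, 3, 1, 2], [1, 3, 1, 2], [0, 2, 0, 2]]
  | 3, 7 => [[3, 1, 0, 1, 2, 1, 2], [0, 1, 0, 1, 2, 3, 2], [3, 2, 0, 3, 2, 0, 2]]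
  | 3, 9 => [[1, 0, 1, 0, 2, 3, 2, 0, 2], [1, 0, 1, 0, 2, 1, 2, 3, 2], [3, 2, 1, 3, 2, 3, 2, 1, 2]]
  | _, _ => []

/-- Five colors, for three rows and column blocks of lengths `3, 5`. -/
def tileSmall : ℕ → ℕ → List (List ℕ)
  | 3, 3 => [[0, 1, 4], [3, 2, 4], [3, 2, 4]]
  | 3, 5 => [[1, 4, 2, 0, 0], [1, 0, 1, 3, 2], [3, 4, 1, 4, 4]]
  | _, _ => []

theorem lidColorable_three_of_even {m n : ℕ} (hm : 3 ≤ m) (hn : 3 ≤ n) (h : Even n) :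
    ((cycleGraph m).tensorProduct (cycleGraph n)).LidColorable 3 := by
  obtain ⟨p, k, hp, hk⟩ : ∃ p k, p ∈ [3, 4, 5] ∧ m = p + 3 * k :=
    ⟨3 + m % 3, m / 3 - 1, by
      have : m % 3 < 3 := Nat.mod_lt _ (by norm_num)
      interval_cases m % 3 <;> simp, by omega⟩
  obtain ⟨p', k', hp', hk'⟩ : ∃ p k, p ∈ [4, 6] ∧ n = p + 4 * k := by
    rw [Nat.even_iff] at h
    rcases (by omega : n % 4 = 0 ∨ n % 4 = 2) with h4 | h4
    · exact ⟨4, n / 4 - 1, by simp, by omega⟩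
    · exact ⟨6, n / 4 - 1, by simp, by omega⟩
  exact lidColorable_of_tiles (S := [3, 4, 5]) (S' := [4, 6]) (T := tileEven) (q := 3) (q' := 4)
    (by decide +kernel) (by decide +kernel) (by simp) (by simp) hp (by simp) hk hm hp' (by simp)
    hk' hn

theorem exists_block_of_odd {n : ℕ} (hn : 5 ≤ n) (h : Odd n) :
    ∃ p k, p ∈ [4, 5, 7] ∧ n = p + 4 * k := by
  rw [Nat.odd_iff] at h
  rcases (by omega : n % 4 = 1 ∨ n % 4 = 3) with h4 | h4
  · exact ⟨5, n / 4 - 1, by simp, by omega⟩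
  · exact ⟨7, n / 4 - 1, by simp, by omega⟩

theorem lidColorable_four_of_odd {m n : ℕ} (hm : 5 ≤ m) (hn : 5 ≤ n) (hm' : Odd m) (hn' : Odd n) :
    ((cycleGraph m).tensorProduct (cycleGraph n)).LidColorable 4 := by
  obtain ⟨p, k, hp, hk⟩ := exists_block_of_odd hm hm'
  obtain ⟨p', k', hp', hk'⟩ := exists_block_of_odd hn hn'
  exact lidColorable_of_tiles (S := [4, 5, 7]) (S' := [4, 5, 7]) (T := tileOdd) (q := 4) (q' := 4)
    (by decide +kernel) (by decide +kernel) (by simp) (by simp) hp (by simp) hk (by omega) hp'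
    (by simp) hk' (by omega)

theorem lidColorable_four_of_three {n : ℕ} (hn : 7 ≤ n) (h : Odd n) :
    ((cycleGraph 3).tensorProduct (cycleGraph n)).LidColorable 4 := by
  obtain ⟨p, k, hp, hk⟩ : ∃ p k, p ∈ [4, 7, 9] ∧ n = p + 4 * k := by
    rw [Nat.odd_iff] at h
    rcases (by omega : n % 4 = 3 ∨ n % 4 = 1) with h4 | h4
    · exact ⟨7, n / 4 - 1, by simp, by omega⟩
    · exact ⟨9, n / 4 - 2, by simp, by omega⟩
  exact lidColorable_of_tiles (S := [3]) (S' := [4, 7, 9]) (T := tileThree) (q := 3) (q' := 4)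
    (k := 0) (p := 3) (by decide +kernel) (by decide +kernel) (by simp) (by simp) (by simp)
    (by simp) (by norm_num) (by norm_num) hp (by simp) hk (by omega)

theorem lidColorable_five_of_three {n : ℕ} (hn : n = 3 ∨ n = 5) :
    ((cycleGraph 3).tensorProduct (cycleGraph n)).LidColorable 5 :=
  lidColorable_of_tiles (S := [3]) (S' := [3, 5]) (T := tileSmall) (p := 3) (q := 3) (k := 0)
    (p' := n) (q' := 3) (k' := 0) (by decide +kernel) (by decide +kernel) (by simp) (by simp)
    (by simp) (by simp) (by norm_num) (by norm_num) (by simpa using hn) (by simp) (by simp)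
    (by omega)

/-! ### The products of a triangle with a triangle and with a pentagon -/

/-- The entry in row `i` of a column of three colors. -/
def columnEntry (i : Fin 3) (t : ℕ × ℕ × ℕ) : ℕ :=
  match i with
  | 0 => t.1
  | 1 => t.2.1
  | 2 => t.2.2

/-- The columns of three colors out of `0, 1, 2, 3`. -/
def columns : List (ℕ × ℕ × ℕ) :=
  [0, 1, 2, 3].flatMap fun a => [0, 1, 2, 3].flatMap fun b => [0, 1, 2, 3].map fun c => (a, b, c)

/-- Two consecutive columns are properly colored in the product of a triangle with a cycle. -/
def columnsProper (t u : ℕ × ℕ × ℕ) : Bool :=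
  t.1 != u.2.1 && t.1 != u.2.2 && t.2.1 != u.1 && t.2.1 != u.2.2 && t.2.2 != u.1 && t.2.2 != u.2.1

/-- Among four consecutive columns in the product of a triangle with a cycle, the edges between the
middle two satisfy the conditions of a lid-coloring. -/
def columnsOK (p q r s : ℕ × ℕ × ℕ) : Bool :=
  patchOK columnEntry 0 1 2 0 p q r s && patchOK columnEntry 1 2 0 1 p q r s &&
    patchOK columnEntry 2 0 1 2 p q r s

/-- The columns that may follow `t` in a proper coloring. -/
def nextColumns (t : ℕ × ℕ × ℕ) : List (ℕ × ℕ × ℕ) := columns.filter (columnsProper t)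

/-- There is no lid-coloring in four colors of the product of two triangles in which the adjacent
vertices `(0, 0)` and `(1, 1)` have the colors `0` and `1`. -/
theorem no_three_columns : ((columns.filter fun a => a.1 == 0).all fun a =>
    ((nextColumns a).filter fun b => b.2.1 == 1).all fun b =>
    (nextColumns b).all fun c =>
      !(columnsProper c a && columnsOK a b c a && columnsOK b c a b && columnsOK c a b c)) =
        true := by
  decide +kernel

/-- There is no lid-coloring in four colors of the product of a triangle with a pentagon in which
the adjacent vertices `(0, 0)` and `(1, 1)` have the colors `0` and `1`. -/
theorem no_five_columns : ((columns.filter fun a => a.1 == 0).all fun a =>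
    ((nextColumns a).filter fun b => b.2.1 == 1).all fun b =>
    (nextColumns b).all fun c => (nextColumns c).all fun d => !columnsOK a b c d ||
      (nextColumns d).all fun e => !(columnsProper e a && columnsOK b c d e &&
        columnsOK c d e a && columnsOK d e a b && columnsOK e a b c)) = true := by
  decide +kernel

/-- A lid-coloring of the product of a triangle with a cycle, read column by column. The colors are
permuted so that the adjacent vertices `(0, 0)` and `(1, 1)` have the colors `0` and `1`; this
divides the number of cases of the search by twelve. -/
theorem LidColorable.exists_columns {n : ℕ}
    (h : ((cycleGraph 3).tensorProduct (cycleGraph (n + 3))).LidColorable 4) :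
    ∃ col : Fin (n + 3) → ℕ × ℕ × ℕ, (∀ j, col j ∈ columns) ∧ (col 0).1 = 0 ∧ (col 1).2.1 = 1 ∧
      (∀ j, columnsProper (col j) (col (j + 1)) = true) ∧
      ∀ j, columnsOK (col j) (col (j + 1)) (col (j + 1 + 1)) (col (j + 1 + 1 + 1)) = true := by
  obtain ⟨f₀, hf₀⟩ := h
  have hadj : ∀ (x y : Fin 3) (j : Fin (n + 3)), x ≠ y →
      ((cycleGraph 3).tensorProduct (cycleGraph (n + 3))).Adj (x, j) (y, j + 1) := by
    refine fun x y j hxy => ⟨cycleGraph_adj_iff.2 ?_, cycleGraph_adj_iff.2 (Or.inl rfl)⟩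
    dsimp only
    revert x y
    decide
  obtain ⟨g, hg0, hg1⟩ : ∃ g : Equiv.Perm (Fin 4), g (f₀ (0, 0)) = 0 ∧ g (f₀ (1, 1)) = 1 := by
    have hne : f₀ (0, 0) ≠ f₀ (1, 1) := by
      have h := hadj 0 1 0 (by decide)
      rw [zero_add] at h
      exact f₀.valid h
    revert hne
    generalize f₀ (0, 0) = x
    generalize f₀ (1, 1) = y
    revert x y
    decide
  obtain ⟨f, hf, hfg⟩ := hf₀.exists_comp g.injective
  rw [← hfg] at hg0 hg1
  let col : Fin (n + 3) → ℕ × ℕ × ℕ := fun j => (f (0, j), f (1, j), f (2, j))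
  have hcol : (fun (x : Fin 3) (y : Fin (n + 3)) => (f (x, y) : ℕ)) =
      fun x y => columnEntry (id x) (col y) := by
    funext x y
    match x with
    | 0 => rfl
    | 1 => rfl
    | 2 => rfl
  have hval : ∀ x y j, x ≠ y → (f (x, j) : ℕ) ≠ f (y, j + 1) := fun x y j hxy h =>
    f.valid (hadj x y j hxy) (Fin.ext h)
  refine ⟨col, fun j => ?_, congrArg Fin.val hg0, congrArg Fin.val hg1, fun j => ?_, fun j => ?_⟩
  · have hlt : ∀ c : Fin 4, (c : ℕ) ∈ [0, 1, 2, 3] := by decide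
    simp only [columns, List.mem_flatMap, List.mem_map]
    exact ⟨_, hlt _, _, hlt _, _, hlt _, rfl⟩
  · simp only [columnsProper, Bool.and_eq_true, bne_iff_ne]
    exact ⟨⟨⟨⟨⟨hval 0 1 j (by decide), hval 0 2 j (by decide)⟩, hval 1 0 j (by decide)⟩,
      hval 1 2 j (by decide)⟩, hval 2 0 j (by decide)⟩, hval 2 1 j (by decide)⟩
  · have hp := fun i : Fin (0 + 3) => hf.patchOK i j
    rw [hcol] at hp
    simp only [patchOK_comp columnEntry id col] at hp
    simp only [columnsOK, Bool.and_eq_true]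
    exact ⟨⟨hp 0, hp 1⟩, hp 2⟩

theorem mem_nextColumns {t u : ℕ × ℕ × ℕ} (hu : u ∈ columns) (h : columnsProper t u = true) :
    u ∈ nextColumns t :=
  List.mem_filter.2 ⟨hu, h⟩

theorem not_lidColorable_four_three_three :
    ¬ ((cycleGraph 3).tensorProduct (cycleGraph 3)).LidColorable 4 := by
  intro h
  obtain ⟨col, hmem, h0, h1, hp, hok⟩ := LidColorable.exists_columns (n := 0) h
  have key := no_three_columns
  simp only [List.all_eq_true, Bool.not_eq_true', Bool.and_eq_false_iff] at key
  have := key (col 0) (List.mem_filter.2 ⟨hmem 0, by simp [h0]⟩)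
    (col 1) (List.mem_filter.2 ⟨mem_nextColumns (hmem 1) (hp 0), by simp [h1]⟩)
    (col 2) (mem_nextColumns (hmem 2) (hp 1))
  have p2 : columnsProper (col 2) (col 0) = true := hp 2
  have o0 : columnsOK (col 0) (col 1) (col 2) (col 0) = true := hok 0
  have o1 : columnsOK (col 1) (col 2) (col 0) (col 1) = true := hok 1
  have o2 : columnsOK (col 2) (col 0) (col 1) (col 2) = true := hok 2
  simp [p2, o0, o1, o2] at this

theorem not_lidColorable_four_three_five :
    ¬ ((cycleGraph 3).tensorProduct (cycleGraph 5)).LidColorable 4 := by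
  intro h
  obtain ⟨col, hmem, h0, h1, hp, hok⟩ := LidColorable.exists_columns (n := 2) h
  have key := no_five_columns
  simp only [List.all_eq_true, Bool.or_eq_true, Bool.not_eq_true', Bool.and_eq_false_iff] at key
  have p4 : columnsProper (col 4) (col 0) = true := hp 4
  have o0 : columnsOK (col 0) (col 1) (col 2) (col 3) = true := hok 0
  have o1 : columnsOK (col 1) (col 2) (col 3) (col 4) = true := hok 1
  have o2 : columnsOK (col 2) (col 3) (col 4) (col 0) = true := hok 2
  have o3 : columnsOK (col 3) (col 4) (col 0) (col 1) = true := hok 3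
  have o4 : columnsOK (col 4) (col 0) (col 1) (col 2) = true := hok 4
  rcases key (col 0) (List.mem_filter.2 ⟨hmem 0, by simp [h0]⟩)
    (col 1) (List.mem_filter.2 ⟨mem_nextColumns (hmem 1) (hp 0), by simp [h1]⟩)
    (col 2) (mem_nextColumns (hmem 2) (hp 1))
    (col 3) (mem_nextColumns (hmem 3) (hp 2)) with h | h
  · simp [o0] at h
  · have := h (col 4) (mem_nextColumns (hmem 4) (hp 3))
    simp [p4, o1, o2, o3, o4] at this

/-! ### The locally identifying chromatic number -/

theorem not_lidColorable_two_tensorProduct_cycleGraph {m n : ℕ} (hm : 3 ≤ m) (hn : 3 ≤ n) :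
    ¬ ((cycleGraph m).tensorProduct (cycleGraph n)).LidColorable 2 := by
  obtain ⟨m, rfl⟩ := Nat.exists_eq_add_of_le' hm
  obtain ⟨n, rfl⟩ := Nat.exists_eq_add_of_le' hn
  have h : ((cycleGraph (m + 3)).tensorProduct (cycleGraph (n + 3))).Adj (0, 0) (0 + 1, 0 + 1) :=
    ⟨cycleGraph_adj_iff.2 (Or.inl rfl), cycleGraph_adj_iff.2 (Or.inl rfl)⟩
  exact not_lidColorable_two h (closedNeighborSet_ne_of_adj _ _ h)

theorem not_lidColorable_three_of_odd {m n : ℕ} (hm : 3 ≤ m) (hn : 3 ≤ n) (hm' : Odd m)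
    (hn' : Odd n) : ¬ ((cycleGraph m).tensorProduct (cycleGraph n)).LidColorable 3 := by
  obtain ⟨m, rfl⟩ := Nat.exists_eq_add_of_le' hm
  obtain ⟨n, rfl⟩ := Nat.exists_eq_add_of_le' hn
  exact fun h => not_isBipartite_tensorProduct_cycleGraph hm' hn'
    (h.isBipartite closedNeighborSet_ne_of_adj)

theorem lidChromaticNumber_of_even {m n : ℕ} (hm : 3 ≤ m) (hn : 3 ≤ n) (h : Even m ∨ Even n) :
    ((cycleGraph m).tensorProduct (cycleGraph n)).lidChromaticNumber = 3 := by
  refine lidChromaticNumber_eq_succ ?_ (not_lidColorable_two_tensorProduct_cycleGraph hm hn)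
  rcases h with h | h
  · exact (lidColorable_three_of_even hn hm h).of_iso (tensorProductComm _ _)
  · exact lidColorable_three_of_even hm hn h

theorem lidChromaticNumber_of_odd {m n : ℕ} (hm : 3 ≤ m) (hn : 3 ≤ n) (hm' : Odd m) (hn' : Odd n)
    (h : ((cycleGraph m).tensorProduct (cycleGraph n)).LidColorable 4) :
    ((cycleGraph m).tensorProduct (cycleGraph n)).lidChromaticNumber = 4 :=
  lidChromaticNumber_eq_succ h (not_lidColorable_three_of_odd hm hn hm' hn')

end SimpleGraph

theorem mainTheorem6 (m n : ℕ) (hm : 3 ≤ m) (hmn : m ≤ n) :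
    ((SimpleGraph.cycleGraph m).tensorProduct (SimpleGraph.cycleGraph n)).lidChromaticNumber =
      if m = 3 ∧ (n = 3 ∨ n = 5) then 5
      else if m = 3 ∧ n = 7 then 4
      else if (m = 5 ∨ m = 7) ∧ (n = 5 ∨ n = 7) then 4
      else if 9 ≤ n ∧ Odd m ∧ Odd n then 4
      else 3 := by
  have hn : 3 ≤ n := hm.trans hmn
  by_cases h35 : m = 3 ∧ (n = 3 ∨ n = 5)
  · rw [if_pos h35]
    obtain ⟨rfl, h⟩ := h35
    refine SimpleGraph.lidChromaticNumber_eq_succ (SimpleGraph.lidColorable_five_of_three h) ?_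
    rcases h with rfl | rfl
    · exact SimpleGraph.not_lidColorable_four_three_three
    · exact SimpleGraph.not_lidColorable_four_three_five
  rw [if_neg h35]
  by_cases hodd : Odd m ∧ Odd n
  · obtain ⟨hm', hn'⟩ := hodd
    have hm2 := Nat.odd_iff.1 hm'
    have hn2 := Nat.odd_iff.1 hn'
    have h4 : ((SimpleGraph.cycleGraph m).tensorProduct
        (SimpleGraph.cycleGraph n)).lidChromaticNumber = 4 := by
      refine SimpleGraph.lidChromaticNumber_of_odd hm hn hm' hn' ?_
      by_cases h3 : m = 3
      · subst h3
        exact SimpleGraph.lidColorable_four_of_three (by omega) hn'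
      · exact SimpleGraph.lidColorable_four_of_odd (by omega) (by omega) hm' hn'
    rw [h4]
    split_ifs with h1 h2 h3
    · rfl
    · rfl
    · rfl
    · exact absurd ⟨by omega, hm', hn'⟩ h3
  · have heven : Even m ∨ Even n := by
      rw [← Nat.not_odd_iff_even, ← Nat.not_odd_iff_even]
      tauto
    have h2 : m % 2 = 0 ∨ n % 2 = 0 := heven.imp Nat.even_iff.1 Nat.even_iff.1
    rw [SimpleGraph.lidChromaticNumber_of_even hm hn heven, if_neg (by omega), if_neg (by omega),
      if_neg fun h => hodd h.2]
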